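/- Let $(E,d)$ be a compact metric space and let $\mathrm{Lip}(E,E)$ be the space of Lipschitz continuous maps from $E$ to $E$, endowed with the distance of uniform convergence on $E$, the corresponding Borel $\sigma$-algebra, and the semigroup structure given by composition. Let $(\mu_x)_{x\in E}$ be a family of probability measures on $\mathrm{Lip}(E,E)$. For every bounded Borel function $\varphi:E\to\mathbb C$ put $$P\varphi(x)=\int_{\mathrm{Lip}(E,E)}\varphi(T(x))\,\mu_x(dT),\qquad x\in E .$$ For $\alpha\in(0,1]$ let $\mathcal H_\alpha(E)$ be the space of functions $\varphi:E\to\mathbb C$ with $m_\alpha(\varphi):=\sup_{x\ne y}|\varphi(x)-\varphi(y)|/d(x,y)^\alpha<\infty$, with norm $\|\varphi\|_\alpha=\sup_E|\varphi|+m_\alpha(\varphi)$. Assume that there exists $\alpha\in(0,1]$ such that (H1) $\displaystyle \sup_{x\neq y}\int_{\mathrm{Lip}(E,E)}\Bigl(\frac{d(T(x),T(y))}{d(x,y)}\Bigr)^{\alpha}\mu_x(dT)<1$; (H2) $\displaystyle \sup_{x\neq y}\frac{|\mu_x-\mu_y|}{d(x,y)^{\alpha}}<\infty$, where $|\mu_x-\mu_y|$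 is the total variation norm of the signed measure $\mu_x-\mu_y$; (H3) there exist $\delta>0$ and a probability measure $\mu$ on $\mathrm{Lip}(E,E)$ such that $\mu_x\ge\delta\mu$ for all $x\in E$, and such that the closed semigroup $T_\mu$ generated by the support of $\mu$ (the closure of the set of all compositions $T_q\cdots T_1$, $q\ge1$, of elements of the support) contains a contracting sequence, i.e. a sequence $(\xi_n)$ for which there is $x_0\in E$ with $\xi_n(x)\to x_0$ for all $x\in E$. (A supremum over the empty set is $0$.) Then there exists on $E$ a unique $P$-invariant Borel probability measure $\nu$, i.e. one with $\nu(P\varphi)=\nu(\varphi)$ for all bounded Borel $\varphi$. Furthermore there exist constants $\kappa>0$ and $\rho\in(0,1)$ such that $$\forall \varphi\in\mathcal H_\alpha(E),\ \forall x\in E,\ \forall n\ge0,\qquad |P^n\varphi(x)-\nu(\varphi)|\le\kappa\,\rho^n\,\|\varphi\|_\alpha .$$ -/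

import Mathlib

open MeasureTheory
open scoped NNReal ENNReal

noncomputable section

namespace IFS

/-- The space of Lipschitz continuous maps from `E` to `E`. -/
def LipMap (E : Type*) [MetricSpace E] : Type _ :=
  {f : C(E, E) // ∃ K : ℝ≥0, LipschitzWith K f}

namespace LipMap

variable {E : Type*} [MetricSpace E]

instance : FunLike (LipMap E) E E where
  coe T := T.1
  coe_injective := fun _ _ h => Subtype.ext (DFunLike.coe_injective h)

/-- The underlying continuous map. -/
def toContinuousMap (T : LipMap E) : C(E, E) := T.1

/-- The distance of uniform convergence on `E`, restricted from `C(E, E)`. -/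
instance [CompactSpace E] : MetricSpace (LipMap E) :=
  inferInstanceAs (MetricSpace {f : C(E, E) // ∃ K : ℝ≥0, LipschitzWith K f})

theorem dist_lt_iff [CompactSpace E] (S T : LipMap E) {c : ℝ} (hc : 0 < c) :
    dist S T < c ↔ ∀ x, dist (S x) (T x) < c :=
  ContinuousMap.dist_lt_iff hc

/-- The Borel sigma-algebra of the uniform distance. -/
instance [CompactSpace E] : MeasurableSpace (LipMap E) := borel (LipMap E)

instance [CompactSpace E] : BorelSpace (LipMap E) := ⟨rfl⟩

/-- Composition of maps: `(S * T) x = S (T x)`. -/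
instance : Semigroup (LipMap E) where
  mul S T := ⟨S.1.comp T.1, by
    obtain ⟨K, hK⟩ := S.2
    obtain ⟨L, hL⟩ := T.2
    exact ⟨K * L, hK.comp hL⟩⟩
  mul_assoc _ _ _ := rfl

theorem mul_apply (S T : LipMap E) (x : E) : (S * T) x = S (T x) := rfl

end LipMap

variable {E : Type*} [MetricSpace E]

/-- A sequence of continuous maps that converges pointwise to a constant. -/
def IsContractingSeq (ξ : ℕ → C(E, E)) : Prop :=
  ∃ x₀ : E, ∀ x : E, Filter.Tendsto (fun n => ξ n x) Filter.atTop (nhds x₀)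

/-- The closed semigroup generated by the support of `m`: the closure of the set of all
products `T_q ⋯ T_1`, `q ≥ 1`, of elements of the support. -/
def closedSemigroup [CompactSpace E] (m : Measure (LipMap E)) : Set (LipMap E) :=
  closure (Subsemigroup.closure m.support : Set (LipMap E))

/-- The contraction coefficient in mean of order `α`, with values in `[0, ∞]`:
`sup_{x ≠ y} ∫ (d(T x, T y) / d(x, y)) ^ α μ_x(dT)`. -/
def meanContraction [CompactSpace E] (α : ℝ≥0) (μ : E → Measure (LipMap E)) : ℝ≥0∞ :=
  ⨆ (x : E) (y : E) (_ : x ≠ y),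
    ∫⁻ T, ENNReal.ofReal ((dist (T x) (T y) / dist x y) ^ (α : ℝ)) ∂(μ x)

/-- The `α`-Hölder coefficient of `x ↦ μ_x` in total variation, with values in `[0, ∞]`:
`sup_{x ≠ y} |μ_x - μ_y| / d(x, y) ^ α`. -/
def tvHolderCoeff [CompactSpace E] (α : ℝ≥0) (μ : E → Measure (LipMap E))
    [∀ x, IsProbabilityMeasure (μ x)] : ℝ≥0∞ :=
  ⨆ (x : E) (y : E) (_ : x ≠ y),
    ((μ x).toSignedMeasure - (μ y).toSignedMeasure).totalVariation Set.univ
      / ENNReal.ofReal (dist x y ^ (α : ℝ))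

/-- The transition operator `P φ (x) = ∫ φ (T x) μ_x(dT)`. -/
def transitionOp [CompactSpace E] (μ : E → Measure (LipMap E)) (φ : E → ℂ) : E → ℂ :=
  fun x => ∫ T, φ (T x) ∂(μ x)

/-- `ν` is `P`-invariant: `ν (P φ) = ν φ` for every bounded Borel function `φ`. -/
def IsInvariant [CompactSpace E] [MeasurableSpace E] (μ : E → Measure (LipMap E))
    (ν : Measure E) : Prop :=
  ∀ φ : E → ℂ, Measurable φ → (∃ C : ℝ, ∀ x, ‖φ x‖ ≤ C) →
    ∫ x, transitionOp μ φ x ∂ν = ∫ x, φ x ∂ν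

/-- The norm `‖φ‖_α = sup |φ| + m_α(φ)` of an `α`-Hölder function. -/
def holderNorm (α : ℝ≥0) (φ : E → ℂ) : ℝ := (⨆ x, ‖φ x‖) + (nnHolderNorm α φ : ℝ)

end IFS

end

/-! Replace `d ^ α` by `min 1 (K d ^ α)` and show that some power of `P` strictly contracts the
Lipschitz seminorm of this truncated distance. Write `a < 1` for the contraction coefficient in (H1)
and `C` for the coefficient in (H2). Where `K d ^ α ≤ 1`, one step of `P` multiplies the seminorm by
at most `a + C / K`, which is below 1 for large `K` (`exists_locallyContracts`). At larger distances
the truncated distance is 1, and it is the oscillation that must drop. By (H3), some product of maps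
in the support of the minorizing measure brings a given pair within truncated distance less than 1.
Maps near its factors have positive mass, so the drop propagates back to the pair, one factor at a
time (`IsMixingPair.of_mem_support`). Compactness of `E × E` makes it uniform
(`exists_truncHolder_contraction`). The oscillation of `P ^ n φ` therefore decays geometrically. A
weak limit of the laws of the chain is then invariant, and the decay gives the rate around any
invariant probability measure, hence uniqueness. -/

/-! ### Comparison of integrals against two measures. -/

section IntegralEstimates

open Filter

variable {X Y : Type*} [MeasurableSpace X] [MeasurableSpace Y]

/-- If `‖f s - g t‖ ≤ c` everywhere, then the integrals of `f` and `g` against two measures of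
the same finite mass `M` differ by at most `c * M`. -/
theorem norm_integral_sub_integral_le_mul_mass {σ : Measure X} {τ : Measure Y}
    [IsFiniteMeasure σ] [IsFiniteMeasure τ] (hmass : σ.real Set.univ = τ.real Set.univ)
    {f : X → ℂ} {g : Y → ℂ} (hf : Integrable f σ) (hg : Integrable g τ) {c : ℝ}
    (h : ∀ s t, ‖f s - g t‖ ≤ c) :
    ‖∫ s, f s ∂σ - ∫ t, g t ∂τ‖ ≤ c * σ.real Set.univ := by
  set M := σ.real Set.univ with hM
  rcases (measureReal_nonneg : 0 ≤ σ.real Set.univ).eq_or_lt with h0 | h0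
  · have hσ : σ = 0 := by
      rw [← Measure.measure_univ_eq_zero]
      exact (measureReal_eq_zero_iff).1 h0.symm
    have hτ : τ = 0 := by
      rw [← Measure.measure_univ_eq_zero]
      exact (measureReal_eq_zero_iff).1 (hmass ▸ h0.symm)
    rw [hM, ← h0]
    simp [hσ, hτ]
  · rw [← hM] at h0
    -- Averaging over `σ` and then over `τ` amounts to integrating against the product measure,
    -- which costs a factor `M` that is cancelled at the end.
    have h1 : ∀ t, ‖∫ s, f s ∂σ - (M : ℂ) * g t‖ ≤ c * M := by
      intro t
      have : ∫ s, f s ∂σ - (M : ℂ) * g t = ∫ s, (f s - g t) ∂σ := by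
        rw [integral_sub hf (integrable_const _), integral_const]
        simp [hM]
      rw [this]
      exact norm_integral_le_of_norm_le_const (Eventually.of_forall fun s => h s t)
    have h2 : ‖∫ t, (∫ s, f s ∂σ - (M : ℂ) * g t) ∂τ‖ ≤ (c * M) * M := by
      rw [hmass]
      exact norm_integral_le_of_norm_le_const (Eventually.of_forall fun t => hmass ▸ h1 t)
    have h3 : ∫ t, (∫ s, f s ∂σ - (M : ℂ) * g t) ∂τ
        = (M : ℂ) * (∫ s, f s ∂σ - ∫ t, g t ∂τ) := by
      rw [integral_sub (integrable_const _) (hg.const_mul _), integral_const,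
        integral_const_mul, ← hmass, Complex.real_smul]
      ring
    rw [h3, norm_mul, Complex.norm_real, Real.norm_of_nonneg h0.le] at h2
    have : M * ‖∫ s, f s ∂σ - ∫ t, g t ∂τ‖ ≤ M * (c * M) := by linarith
    exact le_of_mul_le_mul_left this h0

/-- A function bounded by `c` is integrated against two measures with a discrepancy of at most
`c` times the total variation of their difference. -/
theorem norm_integral_sub_integral_le_totalVariation {μ ν : Measure X} [IsFiniteMeasure μ]
    [IsFiniteMeasure ν] {f : X → ℂ} (hf : StronglyMeasurable f) {c : ℝ} (h : ∀ s, ‖f s‖ ≤ c) :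
    ‖∫ s, f s ∂μ - ∫ s, f s ∂ν‖
      ≤ c * (μ.toSignedMeasure - ν.toSignedMeasure).totalVariation.real Set.univ := by
  set s := μ.toSignedMeasure - ν.toSignedMeasure with hs
  set p := s.toJordanDecomposition.posPart
  set n := s.toJordanDecomposition.negPart
  -- The Jordan decomposition of `μ - ν`, rearranged as an equality of positive measures so that
  -- integrals can be added.
  have key : μ + n = ν + p := by
    rw [← Measure.toSignedMeasure_eq_toSignedMeasure_iff, Measure.toSignedMeasure_add,
      Measure.toSignedMeasure_add]
    have h1 : p.toSignedMeasure - n.toSignedMeasure = s := s.toSignedMeasure_toJordanDecomposition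
    have h2 : p.toSignedMeasure = μ.toSignedMeasure - ν.toSignedMeasure + n.toSignedMeasure := by
      rw [← hs]; exact (sub_eq_iff_eq_add.1 h1)
    rw [h2]; abel
  have hi : ∀ ρ : Measure X, IsFiniteMeasure ρ → Integrable f ρ := fun ρ _ =>
    Integrable.of_bound hf.aestronglyMeasurable c (Eventually.of_forall h)
  have e : ∫ s, f s ∂μ + ∫ s, f s ∂n = ∫ s, f s ∂ν + ∫ s, f s ∂p := by
    rw [← integral_add_measure (hi _ inferInstance) (hi _ inferInstance), key,
      integral_add_measure (hi _ inferInstance) (hi _ inferInstance)]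
  have e' : ∫ s, f s ∂μ - ∫ s, f s ∂ν = ∫ s, f s ∂p - ∫ s, f s ∂n := by
    linear_combination e
  have htv : s.totalVariation.real Set.univ = p.real Set.univ + n.real Set.univ :=
    measureReal_add_apply
  rw [e', htv, mul_add]
  exact (norm_sub_le _ _).trans (add_le_add
    (norm_integral_le_of_norm_le_const (Eventually.of_forall h))
    (norm_integral_le_of_norm_le_const (Eventually.of_forall h)))

end IntegralEstimates

/-! ### The truncated distance and its Lipschitz functions. -/

namespace IFS

open Filter Topology

variable {E : Type*} [MetricSpace E]

/-- The truncated distance `min 1 (K d(x, y) ^ α)`. -/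
noncomputable def truncDist (K : ℝ) (α : ℝ≥0) (x y : E) : ℝ := min 1 (K * dist x y ^ (α : ℝ))

/-- Functions that are `c`-Lipschitz for the truncated distance. -/
def TruncHolder (K : ℝ) (α : ℝ≥0) (c : ℝ) (φ : E → ℂ) : Prop :=
  ∀ x y, ‖φ x - φ y‖ ≤ c * truncDist K α x y

theorem truncDist_le_one (K : ℝ) (α : ℝ≥0) (x y : E) : truncDist K α x y ≤ 1 := min_le_left _ _

theorem truncDist_le (K : ℝ) (α : ℝ≥0) (x y : E) :
    truncDist K α x y ≤ K * dist x y ^ (α : ℝ) := min_le_right _ _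

theorem continuous_dist_rpow (α : ℝ≥0) :
    Continuous fun p : E × E => dist p.1 p.2 ^ (α : ℝ) :=
  continuous_dist.rpow_const fun _ => Or.inr α.2

theorem continuous_truncDist (K : ℝ) (α : ℝ≥0) :
    Continuous fun p : E × E => truncDist K α p.1 p.2 :=
  continuous_const.min (continuous_const.mul (continuous_dist_rpow α))

theorem truncDist_self (K : ℝ) {α : ℝ≥0} (hα : 0 < α) (x : E) : truncDist K α x x = 0 := by
  have : (α : ℝ) ≠ 0 := by positivity
  simp [truncDist, Real.zero_rpow this]

namespace TruncHolder

variable {K : ℝ} {α : ℝ≥0} {c : ℝ} {φ : E → ℂ}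

theorem norm_sub_le (h : TruncHolder K α c φ) (hc : 0 ≤ c) (x y : E) : ‖φ x - φ y‖ ≤ c :=
  (h x y).trans (mul_le_of_le_one_right hc (truncDist_le_one _ _ _ _))

theorem continuous (h : TruncHolder K α c φ) (hα : 0 < α) : Continuous φ := by
  rw [continuous_iff_continuousAt]
  intro x
  rw [ContinuousAt, tendsto_iff_norm_sub_tendsto_zero]
  refine squeeze_zero (fun _ => norm_nonneg _) (fun y => h y x) ?_
  have : Continuous fun y : E => c * truncDist K α y x :=
    continuous_const.mul ((continuous_truncDist K α).comp (continuous_id.prodMk continuous_const))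
  simpa [truncDist_self K hα] using this.tendsto x

end TruncHolder

namespace LipMap

variable [CompactSpace E]

theorem continuous_eval : Continuous fun p : LipMap E × E => p.1 p.2 := by
  have h : Continuous fun p : C(E, E) × E => p.1 p.2 := ContinuousEval.continuous_eval
  have h' : Continuous fun p : LipMap E × E => ((p.1.toContinuousMap : C(E, E)), p.2) :=
    (continuous_subtype_val.comp continuous_fst).prodMk continuous_snd
  exact h.comp h'

theorem continuous_eval_const (x : E) : Continuous fun T : LipMap E => T x :=
  continuous_eval.comp (continuous_id.prodMk continuous_const)

end LipMap

/-! ### One-step estimates for the transition operator. -/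

section Estimates

variable [CompactSpace E] {μ : E → Measure (LipMap E)} [∀ x, IsProbabilityMeasure (μ x)]
  {K : ℝ} {α : ℝ≥0} {a b C c δ : ℝ} {φ : E → ℂ}

theorem stronglyMeasurable_comp_eval (hφ : Continuous φ) (x : E) :
    StronglyMeasurable fun T : LipMap E => φ (T x) :=
  (hφ.comp (LipMap.continuous_eval_const x)).stronglyMeasurable

theorem integrable_comp_eval (hφ : Continuous φ) (x : E) (m : Measure (LipMap E))
    [IsFiniteMeasure m] : Integrable (fun T : LipMap E => φ (T x)) m := by
  obtain ⟨B, hB⟩ := (isCompact_range hφ).isBounded.exists_norm_le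
  exact Integrable.of_bound (stronglyMeasurable_comp_eval hφ x).aestronglyMeasurable B
    (Eventually.of_forall fun T => hB _ ⟨_, rfl⟩)

theorem integrable_dist_rpow (x y : E) (m : Measure (LipMap E))
    [IsFiniteMeasure m] : Integrable (fun T : LipMap E => dist (T x) (T y) ^ (α : ℝ)) m := by
  have hc := continuous_dist_rpow (E := E) α
  obtain ⟨B, hB⟩ := (isCompact_range hc).isBounded.exists_norm_le
  have hm : Continuous fun T : LipMap E => dist (T x) (T y) ^ (α : ℝ) :=
    hc.comp ((LipMap.continuous_eval_const x).prodMk (LipMap.continuous_eval_const y))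
  exact Integrable.of_bound hm.aestronglyMeasurable B
    (Eventually.of_forall fun T => hB _ ⟨(T x, T y), rfl⟩)

/-- The Doeblin–Fortet estimate for the truncated distance. -/
theorem norm_transitionOp_sub_le (hα : 0 < α) (hK : 0 ≤ K) (hc : 0 ≤ c)
    (h1 : ∀ x y, ∫ T, dist (T x) (T y) ^ (α : ℝ) ∂(μ x) ≤ a * dist x y ^ (α : ℝ))
    (h2 : ∀ x y, ((μ x).toSignedMeasure - (μ y).toSignedMeasure).totalVariation.real Set.univ
      ≤ C * dist x y ^ (α : ℝ))
    (hφ : TruncHolder K α c φ) (x y : E) :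
    ‖transitionOp μ φ x - transitionOp μ φ y‖ ≤ c * ((a * K + C) * dist x y ^ (α : ℝ)) := by
  have hcont := hφ.continuous hα
  have hix := integrable_comp_eval hcont x (μ x)
  have hiy := fun z => integrable_comp_eval hcont y (μ z)
  -- Subtracting the constant `φ y` is free between probability measures, and makes the integrand
  -- bounded by `c` instead of by the sup norm of `φ`.
  have e : transitionOp μ φ x - transitionOp μ φ y
      = ∫ T, (φ (T x) - φ (T y)) ∂(μ x)
        + (∫ T, (φ (T y) - φ y) ∂(μ x) - ∫ T, (φ (T y) - φ y) ∂(μ y)) := by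
    rw [integral_sub hix (hiy x), integral_sub (hiy x) (integrable_const _),
      integral_sub (hiy y) (integrable_const _)]
    simp [transitionOp]
  have e1 : ‖∫ T, (φ (T x) - φ (T y)) ∂(μ x)‖ ≤ c * K * (a * dist x y ^ (α : ℝ)) := by
    refine (norm_integral_le_of_norm_le ((integrable_dist_rpow (α := α) x y (μ x)).const_mul (c * K))
      (Eventually.of_forall fun T => ?_)).trans ?_
    · refine (hφ _ _).trans ?_
      rw [mul_assoc]
      exact mul_le_mul_of_nonneg_left (truncDist_le _ _ _ _) hc
    · rw [integral_const_mul]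
      exact mul_le_mul_of_nonneg_left (h1 x y) (mul_nonneg hc hK)
  have e2 : ‖∫ T, (φ (T y) - φ y) ∂(μ x) - ∫ T, (φ (T y) - φ y) ∂(μ y)‖
      ≤ c * (C * dist x y ^ (α : ℝ)) :=
    (norm_integral_sub_integral_le_totalVariation
      ((stronglyMeasurable_comp_eval hcont y).sub stronglyMeasurable_const)
      fun T => hφ.norm_sub_le hc _ _).trans (mul_le_mul_of_nonneg_left (h2 x y) hc)
  rw [e]
  refine (norm_add_le _ _).trans ((add_le_add e1 e2).trans (le_of_eq ?_))
  ring

theorem norm_transitionOp_sub_le_of_le (hφ : Continuous φ) (h : ∀ x y, ‖φ x - φ y‖ ≤ c) (x y : E) :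
    ‖transitionOp μ φ x - transitionOp μ φ y‖ ≤ c := by
  have := norm_integral_sub_integral_le_mul_mass (σ := μ x) (τ := μ y) (by simp)
    (integrable_comp_eval hφ x (μ x)) (integrable_comp_eval hφ y (μ y)) fun s t => h (s x) (t y)
  rwa [probReal_univ, mul_one] at this

/-- If all `μ x` dominate `δ m`, and the maps of a set `V` bring the values of `φ` at the images
of `x` and `y` closer by a factor `1 - η`, then so does the transition operator, by a factor
`1 - δ η m(V)`. -/
theorem norm_transitionOp_sub_le_of_minorization {m : Measure (LipMap E)} [IsProbabilityMeasure m]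
    (hδ : 0 ≤ δ) (hm : ∀ x, ENNReal.ofReal δ • m ≤ μ x) (hφ : Continuous φ)
    (h : ∀ x y, ‖φ x - φ y‖ ≤ c) {V : Set (LipMap E)} (hV : MeasurableSet V) {η : ℝ} {x y : E}
    (hη : ∀ T ∈ V, ‖φ (T x) - φ (T y)‖ ≤ c * (1 - η)) :
    ‖transitionOp μ φ x - transitionOp μ φ y‖ ≤ c * (1 - δ * η * m.real V) := by
  set m' : Measure (LipMap E) := ENNReal.ofReal δ • m with hm'
  have : IsFiniteMeasure m' := ⟨by simp [hm']⟩
  have hdec : ∀ z, μ z = (μ z - m') + m' := fun z => (Measure.sub_add_cancel_of_le (hm z)).symm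
  have hfin : ∀ z, IsFiniteMeasure (μ z - m') := fun z => Measure.isFiniteMeasure_sub
  have hmassm : m'.real Set.univ = δ := by
    simp [hm', measureReal_def, hδ]
  have hmass : ∀ z, (μ z - m').real Set.univ = 1 - δ := by
    intro z
    have : (μ z - m' + m').real Set.univ = (μ z - m').real Set.univ + m'.real Set.univ :=
      measureReal_add_apply
    rw [← hdec z, hmassm, probReal_univ] at this
    linarith
  have hsplit : ∀ z, transitionOp μ φ z
      = ∫ T, φ (T z) ∂(μ z - m') + δ * ∫ T, φ (T z) ∂m := by
    intro z
    have : ∫ T, φ (T z) ∂m' = δ * ∫ T, φ (T z) ∂m := by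
      rw [hm', integral_smul_measure, ENNReal.toReal_ofReal hδ, Complex.real_smul]
    rw [← this, ← integral_add_measure (integrable_comp_eval hφ z _)
      (integrable_comp_eval hφ z _), ← hdec z]
    rfl
  -- The remainders, of equal mass `1 - δ`, are compared independently. On the common part the same
  -- `T` acts at `x` and at `y`, which is where the gain on `V` enters.
  have e1 : ‖∫ T, φ (T x) ∂(μ x - m') - ∫ T, φ (T y) ∂(μ y - m')‖ ≤ c * (1 - δ) := by
    have := norm_integral_sub_integral_le_mul_mass (σ := μ x - m') (τ := μ y - m')
      (by rw [hmass, hmass]) (integrable_comp_eval hφ x _) (integrable_comp_eval hφ y _)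
      (fun s t => h (s x) (t y))
    rwa [hmass] at this
  have e2 : ‖∫ T, φ (T x) ∂m - ∫ T, φ (T y) ∂m‖ ≤ c * (1 - η * m.real V) := by
    rw [← integral_sub (integrable_comp_eval hφ x _) (integrable_comp_eval hφ y _)]
    have hi : Integrable (fun T : LipMap E => c - V.indicator (fun _ => c * η) T) m :=
      (integrable_const _).sub ((integrable_const _).indicator hV)
    refine (norm_integral_le_of_norm_le hi (Eventually.of_forall fun T => ?_)).trans_eq ?_
    · by_cases hT : T ∈ V
      · simpa [hT, mul_sub] using hη T hT
      · simpa [hT] using h (T x) (T y)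
    · rw [integral_sub (integrable_const _) ((integrable_const _).indicator hV),
        integral_indicator_const _ hV]
      simp
      ring
  have e3 : transitionOp μ φ x - transitionOp μ φ y
      = (∫ T, φ (T x) ∂(μ x - m') - ∫ T, φ (T y) ∂(μ y - m'))
        + δ * (∫ T, φ (T x) ∂m - ∫ T, φ (T y) ∂m) := by
    rw [hsplit, hsplit]; ring
  rw [e3]
  refine (norm_add_le _ _).trans ?_
  rw [norm_mul, Complex.norm_real, Real.norm_of_nonneg hδ]
  calc _ ≤ c * (1 - δ) + δ * (c * (1 - η * m.real V)) :=
        add_le_add e1 (mul_le_mul_of_nonneg_left e2 hδ)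
    _ = _ := by ring

end Estimates

/-! ### Strict contraction of a power of the transition operator. -/

section Contraction

variable [CompactSpace E] {μ : E → Measure (LipMap E)} [∀ x, IsProbabilityMeasure (μ x)]
  {K : ℝ} {α : ℝ≥0} {b δ : ℝ}

/-- The transition operator contracts `TruncHolder` functions at small distances. -/
def LocallyContracts (μ : E → Measure (LipMap E)) (K : ℝ) (α : ℝ≥0) (b : ℝ) : Prop :=
  ∀ (c : ℝ) (φ : E → ℂ), 0 ≤ c → TruncHolder K α c φ → ∀ x y,
    ‖transitionOp μ φ x - transitionOp μ φ y‖ ≤ c * (b * (K * dist x y ^ (α : ℝ)))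

/-- Each term of the minimum has its own reason: averaging does not increase oscillation, and `b ≤
1` takes care of the Hölder term. -/
theorem TruncHolder.transitionOp (hP : LocallyContracts μ K α b) (hα : 0 < α) (hK : 0 ≤ K)
    (hb : b ≤ 1) {c : ℝ} (hc : 0 ≤ c) {φ : E → ℂ} (hφ : TruncHolder K α c φ) :
    TruncHolder K α c (transitionOp μ φ) := by
  intro x y
  rw [truncDist, mul_min_of_nonneg _ _ hc]
  refine le_min ?_ ((hP c φ hc hφ x y).trans (mul_le_mul_of_nonneg_left ?_ hc))
  · simpa using norm_transitionOp_sub_le_of_le (hφ.continuous hα) (hφ.norm_sub_le hc) x y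
  · exact mul_le_of_le_one_left (by positivity) hb

theorem TruncHolder.iterate_transitionOp (hP : LocallyContracts μ K α b) (hα : 0 < α)
    (hK : 0 ≤ K) (hb : b ≤ 1) {c : ℝ} (hc : 0 ≤ c) {φ : E → ℂ} (hφ : TruncHolder K α c φ)
    (n : ℕ) : TruncHolder K α c ((IFS.transitionOp μ)^[n] φ) := by
  induction n with
  | zero => exact hφ
  | succ n ih =>
    rw [Function.iterate_succ_apply']
    exact ih.transitionOp hP hα hK hb hc

/-- Near the pair `p`, some iterate of the transition operator uniformly decreases the
oscillation of all `TruncHolder` functions. -/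
def IsMixingPair (μ : E → Measure (LipMap E)) (K : ℝ) (α : ℝ≥0) (p : E × E) : Prop :=
  ∃ (q : ℕ) (η : ℝ), 0 < η ∧ ∀ᶠ p' in 𝓝 p, ∀ (c : ℝ) (φ : E → ℂ), 0 ≤ c →
    TruncHolder K α c φ →
    ‖(transitionOp μ)^[q] φ p'.1 - (transitionOp μ)^[q] φ p'.2‖ ≤ c * (1 - η)

omit [∀ x, IsProbabilityMeasure (μ x)] in
-- No iteration is needed: a level `t` strictly between the truncated distance and 1 gives a uniform
-- gain `1 - t` on a neighbourhood.
theorem isMixingPair_of_truncDist_lt_one {p : E × E} (hp : truncDist K α p.1 p.2 < 1) :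
    IsMixingPair μ K α p := by
  obtain ⟨t, ht, ht1⟩ := exists_between hp
  refine ⟨0, 1 - t, by linarith, ?_⟩
  filter_upwards [(continuous_truncDist K α).continuousAt.eventually_lt_const ht]
    with p' hp' c φ hc hφ
  rw [sub_sub_cancel]
  exact (hφ _ _).trans (mul_le_mul_of_nonneg_left hp'.le hc)

/-- By joint continuity of evaluation, maps in a neighbourhood `V` of `S` send pairs near `(x, y)`
to where `P ^ q φ` already has reduced oscillation. Since `m V > 0`, the minorization turns this
into a gain for `P ^ (q + 1) φ`. -/
theorem IsMixingPair.of_mem_support (hP : LocallyContracts μ K α b) (hα : 0 < α) (hK : 0 ≤ K)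
    (hb : b ≤ 1) {m : Measure (LipMap E)} [IsProbabilityMeasure m] (hδ : 0 < δ)
    (hm : ∀ x, ENNReal.ofReal δ • m ≤ μ x) {S : LipMap E} (hS : S ∈ m.support) {x y : E}
    (h : IsMixingPair μ K α (S x, S y)) : IsMixingPair μ K α (x, y) := by
  obtain ⟨q, η, hη, h⟩ := h
  have hF : Continuous fun z : LipMap E × (E × E) => (z.1 z.2.1, z.1 z.2.2) :=
    (LipMap.continuous_eval.comp (continuous_fst.prodMk (continuous_fst.comp continuous_snd))).prodMk
      (LipMap.continuous_eval.comp
        (continuous_fst.prodMk (continuous_snd.comp continuous_snd)))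
  have h' := (hF.tendsto (S, (x, y))).eventually h
  rw [nhds_prod_eq, eventually_prod_iff] at h'
  obtain ⟨pa, ha, pb, hpb, hab⟩ := h'
  obtain ⟨V, hVsub, hVo, hSV⟩ := mem_nhds_iff.1 ha
  have hmV : 0 < m.real V :=
    ENNReal.toReal_pos ((Measure.mem_support_iff_forall S).1 hS V (hVo.mem_nhds hSV)).ne'
      (measure_ne_top _ _)
  refine ⟨q + 1, δ * η * m.real V, by positivity, ?_⟩
  filter_upwards [hpb] with p' hp' c φ hc hφ
  rw [Function.iterate_succ_apply']
  have hψ := hφ.iterate_transitionOp hP hα hK hb hc q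
  exact norm_transitionOp_sub_le_of_minorization hδ.le hm (hψ.continuous hα)
    (hψ.norm_sub_le hc) hVo.measurableSet fun T hT => hab (hVsub hT) hp' c φ hc hφ

theorem IsMixingPair.of_mem_subsemigroup (hP : LocallyContracts μ K α b) (hα : 0 < α) (hK : 0 ≤ K)
    (hb : b ≤ 1) {m : Measure (LipMap E)} [IsProbabilityMeasure m] (hδ : 0 < δ)
    (hm : ∀ x, ENNReal.ofReal δ • m ≤ μ x) {S : LipMap E}
    (hS : S ∈ Subsemigroup.closure m.support) :
    ∀ {x y : E}, IsMixingPair μ K α (S x, S y) → IsMixingPair μ K α (x, y) := by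
  induction hS using Subsemigroup.closure_induction with
  | mem S hS => exact fun h => h.of_mem_support hP hα hK hb hδ hm hS
  -- The outer factor `S` is removed first, at the pair `(T x, T y)`; hence the pair is quantified
  -- inside the induction.
  | mul S T _ _ ihS ihT => exact fun h => ihT (ihS h)

/-- Some `ξ n` brings `x` and `y` within truncated distance less than 1. This is an open condition
on the map, so a genuine finite product in the subsemigroup satisfies it too. -/
theorem isMixingPair_of_contractingSeq (hP : LocallyContracts μ K α b) (hα : 0 < α) (hK : 0 ≤ K)
    (hb : b ≤ 1) {m : Measure (LipMap E)} [IsProbabilityMeasure m] (hδ : 0 < δ)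
    (hm : ∀ x, ENNReal.ofReal δ • m ≤ μ x) {ξ : ℕ → LipMap E}
    (hξ : ∀ n, ξ n ∈ closedSemigroup m)
    (hc : IsContractingSeq fun n => (ξ n).toContinuousMap) (p : E × E) :
    IsMixingPair μ K α p := by
  obtain ⟨x, y⟩ := p
  obtain ⟨x₀, hx₀⟩ := hc
  have h1 : Tendsto (fun n => truncDist K α (ξ n x) (ξ n y)) atTop (𝓝 0) := by
    have := ((continuous_truncDist (E := E) K α).tendsto (x₀, x₀)).comp
      ((hx₀ x).prodMk_nhds (hx₀ y))
    rwa [truncDist_self K hα] at this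
  obtain ⟨n, hn⟩ := (h1.eventually_lt_const one_pos).exists
  have h2 : Continuous fun S : LipMap E => truncDist K α (S x) (S y) :=
    (continuous_truncDist K α).comp
      ((LipMap.continuous_eval_const x).prodMk (LipMap.continuous_eval_const y))
  obtain ⟨S, hS1, hS2⟩ := mem_closure_iff.1 (hξ n) _ (isOpen_lt h2 continuous_const) hn
  exact IsMixingPair.of_mem_subsemigroup hP hα hK hb hδ hm hS2
    (isMixingPair_of_truncDist_lt_one hS1)

/-- If every pair is mixing, then a power of the transition operator is a strict contraction for
the Lipschitz seminorm of the truncated distance. -/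
theorem exists_truncHolder_contraction (hP : LocallyContracts μ K α b) (hα : 0 < α) (hK : 0 ≤ K)
    (hb0 : 0 ≤ b) (hb : b < 1) (hmix : ∀ p : E × E, IsMixingPair μ K α p) :
    ∃ (N : ℕ) (θ : ℝ), 0 < N ∧ 0 ≤ θ ∧ θ < 1 ∧ ∀ (c : ℝ) (φ : E → ℂ), 0 ≤ c →
      TruncHolder K α c φ → TruncHolder K α (c * θ) ((transitionOp μ)^[N] φ) := by
  -- Quantifying over all `N ≥ N₀` lets finitely many neighbourhoods share one exponent. This costs
  -- nothing: the extra iterates are applied to `φ` first and preserve its constant `c`.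
  have key : ∃ (N₀ : ℕ) (η : ℝ), 0 < η ∧ ∀ N ≥ N₀, ∀ p ∈ (Set.univ : Set (E × E)),
      ∀ (c : ℝ) (φ : E → ℂ), 0 ≤ c → TruncHolder K α c φ →
      ‖(transitionOp μ)^[N] φ p.1 - (transitionOp μ)^[N] φ p.2‖ ≤ c * (1 - η) := by
    refine IsCompact.induction_on (p := fun s : Set (E × E) => ∃ (N₀ : ℕ) (η : ℝ), 0 < η ∧
      ∀ N ≥ N₀, ∀ p ∈ s, ∀ (c : ℝ) (φ : E → ℂ), 0 ≤ c → TruncHolder K α c φ →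
      ‖(transitionOp μ)^[N] φ p.1 - (transitionOp μ)^[N] φ p.2‖ ≤ c * (1 - η))
      isCompact_univ ?_ ?_ ?_ ?_
    · exact ⟨0, 1, one_pos, by simp⟩
    · rintro s t hst ⟨N₀, η, hη, h⟩
      exact ⟨N₀, η, hη, fun N hN p hp => h N hN p (hst hp)⟩
    · rintro s t ⟨N₁, η₁, h₁, hs⟩ ⟨N₂, η₂, h₂, ht⟩
      refine ⟨max N₁ N₂, min η₁ η₂, lt_min h₁ h₂, fun N hN p hp c φ hc hφ => ?_⟩
      rcases hp with hp | hp
      · refine (hs N (le_of_max_le_left hN) p hp c φ hc hφ).trans ?_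
        gcongr
        exact min_le_left _ _
      · refine (ht N (le_of_max_le_right hN) p hp c φ hc hφ).trans ?_
        gcongr
        exact min_le_right _ _
    · intro p _
      obtain ⟨q, η, hη, h⟩ := hmix p
      refine ⟨_, mem_nhdsWithin_of_mem_nhds h, q, η, hη, fun N hN p' hp' c φ hc hφ => ?_⟩
      obtain ⟨r, rfl⟩ := Nat.exists_eq_add_of_le hN
      rw [Function.iterate_add_apply]
      exact hp' c _ hc (hφ.iterate_transitionOp hP hα hK hb.le hc r)
  obtain ⟨N₀, η, hη, h⟩ := key
  -- The additional step supplies the factor `b` at close pairs; far pairs get `1 - η`.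
  refine ⟨N₀ + 1, max b (1 - η), N₀.succ_pos, le_max_of_le_left hb0,
    max_lt hb (by linarith), fun c φ hc hφ x y => ?_⟩
  rcases le_total (K * dist x y ^ (α : ℝ)) 1 with hxy | hxy
  · rw [truncDist, min_eq_right hxy, Function.iterate_succ_apply', mul_assoc]
    refine (hP c _ hc (hφ.iterate_transitionOp hP hα hK hb.le hc N₀) x y).trans ?_
    gcongr
    exact le_max_left _ _
  · rw [truncDist, min_eq_left hxy, mul_one]
    refine (h (N₀ + 1) N₀.le_succ (x, y) trivial c φ hc hφ).trans ?_
    gcongr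
    exact le_max_right _ _

theorem exists_pow_div_le_mul_pow {N : ℕ} (hN : 0 < N) {θ : ℝ} (hθ0 : 0 ≤ θ) (hθ1 : θ < 1) :
    ∃ κ ρ : ℝ, 0 < κ ∧ 0 < ρ ∧ ρ < 1 ∧ ∀ n : ℕ, θ ^ (n / N) ≤ κ * ρ ^ n := by
  -- Passing to `t > θ` keeps `ρ = t ^ (1 / N)` positive even if `θ = 0`; the factor `t⁻¹` absorbs
  -- the rounding in `n / N`.
  obtain ⟨t, ht, ht1⟩ := exists_between hθ1
  have ht0 : 0 < t := hθ0.trans_lt ht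
  have hN' : (0 : ℝ) < N := by exact_mod_cast hN
  refine ⟨t⁻¹, t ^ (1 / (N : ℝ)), by positivity, by positivity,
    Real.rpow_lt_one ht0.le ht1 (by positivity), fun n => ?_⟩
  have h1 : (n : ℝ) / N ≤ (n / N : ℕ) + 1 := by
    rw [div_le_iff₀ hN']
    exact_mod_cast (Nat.lt_div_mul_add hN (a := n)).le.trans_eq (by ring)
  calc θ ^ (n / N) ≤ t ^ (n / N) := pow_le_pow_left₀ hθ0 ht.le _
    _ = t⁻¹ * t ^ (((n / N : ℕ) : ℝ) + 1) := by
        rw [Real.rpow_add ht0, Real.rpow_one, Real.rpow_natCast]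
        field_simp
    _ ≤ t⁻¹ * t ^ ((n : ℝ) / N) := by
        gcongr ?_ * ?_
        exact Real.rpow_le_rpow_of_exponent_ge ht0 ht1.le h1
    _ = t⁻¹ * (t ^ (1 / (N : ℝ))) ^ n := by
        rw [← Real.rpow_natCast, ← Real.rpow_mul ht0.le]
        congr 2
        ring

/-- The oscillation of the iterates of `TruncHolder` functions decays geometrically. -/
theorem exists_geometric_oscillation_decay (hP : LocallyContracts μ K α b) (hα : 0 < α)
    (hK : 0 ≤ K) (hb0 : 0 ≤ b) (hb : b < 1) (hmix : ∀ p : E × E, IsMixingPair μ K α p) :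
    ∃ κ ρ : ℝ, 0 < κ ∧ 0 < ρ ∧ ρ < 1 ∧ ∀ (c : ℝ) (φ : E → ℂ), 0 ≤ c → TruncHolder K α c φ →
      ∀ (n : ℕ) (x y : E),
        ‖(transitionOp μ)^[n] φ x - (transitionOp μ)^[n] φ y‖ ≤ κ * ρ ^ n * c := by
  obtain ⟨N, θ, hN, hθ0, hθ1, h⟩ := exists_truncHolder_contraction hP hα hK hb0 hb hmix
  obtain ⟨κ, ρ, hκ, hρ0, hρ1, hle⟩ := exists_pow_div_le_mul_pow hN hθ0 hθ1
  refine ⟨κ, ρ, hκ, hρ0, hρ1, fun c φ hc hφ n x y => ?_⟩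
  have h1 : ∀ k : ℕ, TruncHolder K α (c * θ ^ k) (((transitionOp μ)^[N])^[k] φ) := by
    intro k
    induction k with
    | zero => simpa using hφ
    | succ k ih =>
      rw [Function.iterate_succ_apply', pow_succ, ← mul_assoc]
      exact h _ _ (by positivity) ih
  have hc' : 0 ≤ c * θ ^ (n / N) := by positivity
  -- The `n % N` leftover steps do not increase the constant.
  have h2 := ((h1 (n / N)).iterate_transitionOp hP hα hK hb.le hc' (n % N)).norm_sub_le hc' x y
  rw [← Function.iterate_mul, ← Function.iterate_add_apply, Nat.mod_add_div] at h2
  refine h2.trans ?_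
  rw [mul_comm c]
  exact mul_le_mul_of_nonneg_right (hle n) hc

end Contraction

theorem holderNorm_nonneg (α : ℝ≥0) (φ : E → ℂ) : 0 ≤ holderNorm α φ :=
  add_nonneg (Real.iSup_nonneg fun _ => norm_nonneg _) (NNReal.coe_nonneg _)

/-! ### Consequences of (H1) and (H2). -/

section Hypotheses

variable [CompactSpace E] {μ : E → Measure (LipMap E)} [∀ x, IsProbabilityMeasure (μ x)]
  {α : ℝ≥0}

omit [∀ x, IsProbabilityMeasure (μ x)] in
theorem integral_dist_rpow_le (hα : 0 < α) (h : meanContraction α μ ≠ ∞) (x y : E) :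
    ∫ T, dist (T x) (T y) ^ (α : ℝ) ∂(μ x) ≤ (meanContraction α μ).toReal * dist x y ^ (α : ℝ) := by
  rcases eq_or_ne x y with rfl | hxy
  · have : (α : ℝ) ≠ 0 := by positivity
    simp [Real.zero_rpow this]
  · have hd : 0 < dist x y ^ (α : ℝ) := Real.rpow_pos_of_pos (dist_pos.2 hxy) _
    have h1 : ∫⁻ T, ENNReal.ofReal ((dist (T x) (T y) / dist x y) ^ (α : ℝ)) ∂(μ x)
        ≤ meanContraction α μ :=
      le_iSup_of_le x (le_iSup_of_le y (le_iSup_of_le hxy le_rfl))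
    have hm : Continuous fun T : LipMap E => (dist (T x) (T y) / dist x y) ^ (α : ℝ) :=
      (((LipMap.continuous_eval_const x).dist (LipMap.continuous_eval_const y)).div_const
        _).rpow_const fun _ => Or.inr α.2
    have h2 : ∫ T, (dist (T x) (T y) / dist x y) ^ (α : ℝ) ∂(μ x)
        ≤ (meanContraction α μ).toReal := by
      rw [integral_eq_lintegral_of_nonneg_ae (Eventually.of_forall fun T => by positivity)
        hm.aestronglyMeasurable]
      exact ENNReal.toReal_mono h h1
    have h3 : ∀ T : LipMap E, (dist (T x) (T y) / dist x y) ^ (α : ℝ)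
        = dist (T x) (T y) ^ (α : ℝ) / dist x y ^ (α : ℝ) := fun T =>
      Real.div_rpow dist_nonneg dist_nonneg _
    simp_rw [h3] at h2
    rwa [integral_div, div_le_iff₀ hd] at h2

theorem totalVariation_le (h : tvHolderCoeff α μ ≠ ∞) (x y : E) :
    ((μ x).toSignedMeasure - (μ y).toSignedMeasure).totalVariation.real Set.univ
      ≤ (tvHolderCoeff α μ).toReal * dist x y ^ (α : ℝ) := by
  rcases eq_or_ne x y with rfl | hxy
  · rw [sub_self, SignedMeasure.totalVariation_zero, measureReal_zero]
    positivity
  · have hd : 0 < dist x y ^ (α : ℝ) := Real.rpow_pos_of_pos (dist_pos.2 hxy) _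
    have h1 : ((μ x).toSignedMeasure - (μ y).toSignedMeasure).totalVariation Set.univ
        / ENNReal.ofReal (dist x y ^ (α : ℝ)) ≤ tvHolderCoeff α μ :=
      le_iSup_of_le x (le_iSup_of_le y (le_iSup_of_le hxy le_rfl))
    rw [ENNReal.div_le_iff (by simpa using hd) ENNReal.ofReal_ne_top] at h1
    have := ENNReal.toReal_mono (ENNReal.mul_ne_top h ENNReal.ofReal_ne_top) h1
    rwa [ENNReal.toReal_mul, ENNReal.toReal_ofReal hd.le] at this

theorem exists_locallyContracts (hα : 0 < α) (H1 : meanContraction α μ < 1)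
    (H2 : tvHolderCoeff α μ < ∞) :
    ∃ K b : ℝ, 1 ≤ K ∧ 0 ≤ b ∧ b < 1 ∧ LocallyContracts μ K α b := by
  set a := (meanContraction α μ).toReal
  set C := (tvHolderCoeff α μ).toReal
  have ha0 : 0 ≤ a := ENNReal.toReal_nonneg
  have hC0 : 0 ≤ C := ENNReal.toReal_nonneg
  have ha1 : a < 1 := by
    have := (ENNReal.toReal_lt_toReal H1.ne_top ENNReal.one_ne_top).2 H1
    simpa using this
  have hpos : 0 < 1 - a := by linarith
  -- With `b` midway between `a` and 1, the requirement `a K + C ≤ b K` reads `C ≤ K (1 - a) / 2`.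
  -- The summand 1 ensures `K ≥ 1`.
  refine ⟨1 + 2 * C / (1 - a), (1 + a) / 2, ?_, by linarith, by linarith,
    fun c φ hc hφ x y => ?_⟩
  · have : 0 ≤ 2 * C / (1 - a) := by positivity
    linarith
  · refine (norm_transitionOp_sub_le hα (by positivity) hc (integral_dist_rpow_le hα H1.ne_top)
      (totalVariation_le H2.ne) hφ x y).trans ?_
    rw [← mul_assoc ((1 + a) / 2)]
    refine mul_le_mul_of_nonneg_left (mul_le_mul_of_nonneg_right ?_ (by positivity)) hc
    have : 2 * C / (1 - a) * (1 - a) = 2 * C := div_mul_cancel₀ _ hpos.ne'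
    change a * _ + C ≤ _
    nlinarith

/-- Measurability of the family comes from (H2): the mass of each fixed measurable set depends
continuously on `x`. -/
theorem measurable_of_tvHolderCoeff [MeasurableSpace E] [BorelSpace E] (hα : 0 < α)
    (h : tvHolderCoeff α μ ≠ ∞) : Measurable μ := by
  refine Measure.measurable_of_measurable_coe _ fun s hs => ?_
  have hc : Continuous fun x => (μ x).real s := by
    rw [continuous_iff_continuousAt]
    intro x
    rw [ContinuousAt, tendsto_iff_norm_sub_tendsto_zero]
    have hb : ∀ y, ‖(μ y).real s - (μ x).real s‖
        ≤ (tvHolderCoeff α μ).toReal * dist y x ^ (α : ℝ) := by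
      intro y
      refine le_trans ?_ (totalVariation_le h y x)
      refine le_trans ?_ (measureReal_mono (Set.subset_univ s))
      have := SignedMeasure.norm_le_totalVariation
        ((μ y).toSignedMeasure - (μ x).toSignedMeasure) s
      rwa [Measure.toSignedMeasure_sub_apply hs] at this
    refine squeeze_zero (fun _ => norm_nonneg _) hb ?_
    have : Continuous fun y => (tvHolderCoeff α μ).toReal * dist y x ^ (α : ℝ) :=
      continuous_const.mul
        ((continuous_dist_rpow α).comp (continuous_id.prodMk continuous_const))
    have hα' : (α : ℝ) ≠ 0 := by positivity
    simpa [Real.zero_rpow hα'] using this.tendsto x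
  have e : (fun x => μ x s) = fun x => ENNReal.ofReal ((μ x).real s) := by
    ext x
    simp
  rw [e]
  exact hc.measurable.ennreal_ofReal

omit [∀ x, IsProbabilityMeasure (μ x)] in
theorem truncHolder_of_memHolder (hα : 0 < α) {K : ℝ} (hK : 1 ≤ K) {φ : E → ℂ}
    (hφ : MemHolder α φ) : TruncHolder K α (2 * holderNorm α φ) φ := by
  intro x y
  have hcont : Continuous φ := hφ.holderWith.continuous hα
  -- A real supremum takes the default value 0 on an unbounded family, so compactness is needed for
  -- `holderNorm` to control `φ`.
  have hbdd : BddAbove (Set.range fun x => ‖φ x‖) := (isCompact_range hcont.norm).bddAbove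
  have hsup : ∀ z, ‖φ z‖ ≤ ⨆ x, ‖φ x‖ := le_ciSup hbdd
  have hsup0 : 0 ≤ ⨆ x, ‖φ x‖ := (norm_nonneg _).trans (hsup x)
  have hn : 0 ≤ (nnHolderNorm α φ : ℝ) := NNReal.coe_nonneg _
  have hd : 0 ≤ dist x y ^ (α : ℝ) := by positivity
  have h1 : ‖φ x - φ y‖ ≤ nnHolderNorm α φ * dist x y ^ (α : ℝ) := by
    rw [← dist_eq_norm]
    exact hφ.holderWith.dist_le x y
  rw [truncDist, mul_min_of_nonneg _ _ (by unfold holderNorm; positivity), holderNorm]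
  refine le_min ?_ (h1.trans ?_)
  · have := norm_sub_le (φ x) (φ y)
    linarith [hsup x, hsup y]
  · rw [← mul_assoc]
    refine mul_le_mul_of_nonneg_right ?_ hd
    nlinarith

end Hypotheses

/-! ### The Markov kernel and Lipschitz test functions. -/

section Kernel

open ProbabilityTheory

variable [CompactSpace E] [MeasurableSpace E] [BorelSpace E] {μ : E → Measure (LipMap E)}
  [∀ x, IsProbabilityMeasure (μ x)]

omit [MeasurableSpace E] [BorelSpace E] in
instance : SecondCountableTopology (LipMap E) :=
  inferInstanceAs (SecondCountableTopology {f : C(E, E) // ∃ K : ℝ≥0, LipschitzWith K f})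

theorem measurable_eval_const (x : E) : Measurable fun T : LipMap E => T x :=
  (LipMap.continuous_eval_const x).measurable

/-- The Markov kernel `x ↦ (law of T x under μ_x)`. -/
noncomputable def stepKernel (μ : E → Measure (LipMap E)) [∀ x, IsProbabilityMeasure (μ x)]
    (hμ : Measurable μ) : Kernel E E where
  toFun x := (μ x).map fun T => T x
  measurable' := by
    refine Measure.measurable_of_measurable_coe _ fun s hs => ?_
    let κ : Kernel E (LipMap E) := ⟨μ, hμ⟩
    have : IsMarkovKernel κ := ⟨fun x => inferInstanceAs (IsProbabilityMeasure (μ x))⟩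
    have ht : MeasurableSet {p : E × LipMap E | p.2 p.1 ∈ s} :=
      (LipMap.continuous_eval.comp continuous_swap).measurable hs
    have := Kernel.measurable_kernel_prodMk_left (κ := κ) ht
    convert this using 2 with x
    rw [Measure.map_apply (measurable_eval_const x) hs]
    rfl

theorem stepKernel_apply (hμ : Measurable μ) (x : E) :
    stepKernel μ hμ x = (μ x).map fun T => T x := rfl

instance (hμ : Measurable μ) : IsMarkovKernel (stepKernel μ hμ) :=
  ⟨fun x => Measure.isProbabilityMeasure_map (measurable_eval_const x).aemeasurable⟩

theorem integral_comp_stepKernel (hμ : Measurable μ) (ρ : Measure E) [IsFiniteMeasure ρ]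
    {φ : E → ℂ} (hφ : Measurable φ) {C : ℝ} (hC : ∀ x, ‖φ x‖ ≤ C) :
    ∫ x, φ x ∂(stepKernel μ hμ ∘ₘ ρ) = ∫ x, transitionOp μ φ x ∂ρ := by
  have hi : Integrable φ (stepKernel μ hμ ∘ₘ ρ) :=
    Integrable.of_bound hφ.aestronglyMeasurable C (Eventually.of_forall hC)
  rw [Measure.comp_eq_comp_const_apply] at hi ⊢
  rw [Kernel.integral_comp hi, Kernel.const_apply]
  refine integral_congr_ae (Eventually.of_forall fun x => ?_)
  simp only [stepKernel_apply]
  rw [integral_map (measurable_eval_const x).aemeasurable hφ.aestronglyMeasurable]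
  rfl

omit [CompactSpace E] in
/-- Probability measures that integrate Lipschitz functions equally are equal. -/
theorem ext_of_forall_lipschitz_integral_eq {P Q : Measure E}
    [IsProbabilityMeasure P] [IsProbabilityMeasure Q]
    (h : ∀ f : E → ℝ, (∃ L, LipschitzWith L f) → ∫ x, (f x : ℂ) ∂P = ∫ x, (f x : ℂ) ∂Q) :
    P = Q := by
  let P' : ProbabilityMeasure E := ⟨P, inferInstance⟩
  let Q' : ProbabilityMeasure E := ⟨Q, inferInstance⟩
  -- Lipschitz functions determine weak convergence, so the constant sequence `P'` also converges to
  -- `Q'`; uniqueness of limits concludes.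
  have h1 : Tendsto (fun _ : ℕ => P') atTop (𝓝 Q') := by
    rw [tendsto_iff_forall_lipschitz_integral_tendsto]
    intro f _ hf
    have := h f hf
    rw [integral_complex_ofReal, integral_complex_ofReal, Complex.ofReal_inj] at this
    change Tendsto (fun _ => ∫ x, f x ∂P) _ (𝓝 (∫ x, f x ∂Q))
    rw [this]
    exact tendsto_const_nhds
  have h2 : P' = Q' := tendsto_nhds_unique tendsto_const_nhds h1
  exact congrArg Subtype.val h2

omit [MeasurableSpace E] [BorelSpace E] in
-- On a bounded space the Hölder classes decrease with the exponent, so `α ≤ 1` makes Lipschitz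
-- functions admissible.
theorem memHolder_ofReal_comp {α : ℝ≥0} (hα1 : α ≤ 1) {f : E → ℝ} (hf : ∃ L, LipschitzWith L f) :
    MemHolder α fun x => (f x : ℂ) := by
  obtain ⟨L, hL⟩ := hf
  have : LipschitzWith (1 * L) fun x => (f x : ℂ) :=
    Complex.isometry_ofReal.lipschitz.comp hL
  exact (holderWith_one.2 this).memHolder.of_le hα1

omit [MeasurableSpace E] [BorelSpace E] in
theorem exists_norm_le_of_continuous {φ : E → ℂ} (hφ : Continuous φ) : ∃ C : ℝ, ∀ x, ‖φ x‖ ≤ C := by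
  obtain ⟨B, hB⟩ := (isCompact_range hφ).isBounded.exists_norm_le
  exact ⟨B, fun x => hB _ ⟨x, rfl⟩⟩

end Kernel

/-! ### Invariant measures: convergence rate and existence. -/

section Invariant

open ProbabilityTheory

variable [CompactSpace E] [MeasurableSpace E] [BorelSpace E] {μ : E → Measure (LipMap E)}
  [∀ x, IsProbabilityMeasure (μ x)] {K b : ℝ} {α : ℝ≥0}

theorem IsInvariant.integral_iterate {ν : Measure E} (hν : IsInvariant μ ν)
    (hP : LocallyContracts μ K α b) (hα : 0 < α) (hK : 0 ≤ K) (hb : b ≤ 1) {c : ℝ} (hc : 0 ≤ c)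
    {φ : E → ℂ} (hφ : TruncHolder K α c φ) (n : ℕ) :
    ∫ x, (transitionOp μ)^[n] φ x ∂ν = ∫ x, φ x ∂ν := by
  induction n with
  | zero => rfl
  | succ n ih =>
    have h := (hφ.iterate_transitionOp hP hα hK hb hc n).continuous hα
    rw [Function.iterate_succ_apply', ← ih]
    exact hν _ h.measurable (exists_norm_le_of_continuous h)

/-- The distance from an iterate to the mean of `φ` is at most the oscillation of the iterate. -/
theorem IsInvariant.norm_iterate_sub_integral_le {ν : Measure E} [IsProbabilityMeasure ν]
    (hν : IsInvariant μ ν) (hP : LocallyContracts μ K α b) (hα : 0 < α) (hK : 0 ≤ K) (hb : b ≤ 1)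
    {c : ℝ} (hc : 0 ≤ c) {φ : E → ℂ} (hφ : TruncHolder K α c φ) {n : ℕ} {r : ℝ}
    (h : ∀ x y, ‖(transitionOp μ)^[n] φ x - (transitionOp μ)^[n] φ y‖ ≤ r) (x : E) :
    ‖(transitionOp μ)^[n] φ x - ∫ y, φ y ∂ν‖ ≤ r := by
  have hψ := (hφ.iterate_transitionOp hP hα hK hb hc n).continuous hα
  obtain ⟨B, hB⟩ := exists_norm_le_of_continuous hψ
  have hi : Integrable ((transitionOp μ)^[n] φ) ν :=
    Integrable.of_bound hψ.measurable.aestronglyMeasurable B (Eventually.of_forall hB)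
  rw [← hν.integral_iterate hP hα hK hb hc hφ n]
  have e : (transitionOp μ)^[n] φ x - ∫ y, (transitionOp μ)^[n] φ y ∂ν
      = ∫ y, ((transitionOp μ)^[n] φ x - (transitionOp μ)^[n] φ y) ∂ν := by
    rw [integral_sub (integrable_const _) hi]
    simp
  rw [e]
  simpa using norm_integral_le_of_norm_le_const (μ := ν) (Eventually.of_forall fun y => h x y)

/-- The law at time `n` of the chain started at `x₀`. -/
noncomputable def chainLaw (μ : E → Measure (LipMap E)) [∀ x, IsProbabilityMeasure (μ x)]
    (hμ : Measurable μ) (x₀ : E) : ℕ → ProbabilityMeasure E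
  | 0 => ⟨Measure.dirac x₀, inferInstance⟩
  | n + 1 => ⟨stepKernel μ hμ ∘ₘ (chainLaw μ hμ x₀ n : Measure E), inferInstance⟩

theorem integral_chainLaw (hμ : Measurable μ) (x₀ : E) (hP : LocallyContracts μ K α b)
    (hα : 0 < α) (hK : 0 ≤ K) (hb : b ≤ 1) (n : ℕ) {c : ℝ} (hc : 0 ≤ c) {φ : E → ℂ}
    (hφ : TruncHolder K α c φ) :
    ∫ x, φ x ∂(chainLaw μ hμ x₀ n : Measure E) = (transitionOp μ)^[n] φ x₀ := by
  induction n generalizing φ with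
  | zero => exact integral_dirac _ _
  | succ n ih =>
    have h := hφ.continuous hα
    obtain ⟨B, hB⟩ := exists_norm_le_of_continuous h
    rw [Function.iterate_succ_apply, ← ih (hφ.transitionOp hP hα hK hb hc)]
    exact integral_comp_stepKernel hμ _ h.measurable hB

/-- A measure whose image under the step kernel integrates Lipschitz functions in the same way
is invariant. -/
theorem isInvariant_of_comp_eq (hμ : Measurable μ) {ν : Measure E} [IsProbabilityMeasure ν]
    (h : stepKernel μ hμ ∘ₘ ν = ν) : IsInvariant μ ν := by
  rintro φ hφ ⟨C, hC⟩
  rw [← integral_comp_stepKernel hμ ν hφ hC, h]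

/-- Any weak limit of the laws of the chain works, without Cesàro averaging, because the decay of
oscillation forces `P ^ (n + 1) φ x₀ - P ^ n φ x₀ → 0`. An ultrafilter limit avoids extracting a
subsequence. -/
theorem exists_isInvariant (hμ : Measurable μ) (x₀ : E) (hP : LocallyContracts μ K α b)
    (hα : 0 < α) (hα1 : α ≤ 1) (hK : 1 ≤ K) (hb : b ≤ 1)
    (hdecay : ∃ κ ρ : ℝ, 0 < κ ∧ 0 < ρ ∧ ρ < 1 ∧ ∀ (c : ℝ) (φ : E → ℂ), 0 ≤ c →
      TruncHolder K α c φ → ∀ (n : ℕ) (x y : E),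
        ‖(transitionOp μ)^[n] φ x - (transitionOp μ)^[n] φ y‖ ≤ κ * ρ ^ n * c) :
    ∃ ν : Measure E, IsProbabilityMeasure ν ∧ IsInvariant μ ν := by
  obtain ⟨κ, ρ, hκ, hρ0, hρ1, hdec⟩ := hdecay
  have hK0 : 0 ≤ K := zero_le_one.trans hK
  obtain ⟨ν, -, hν⟩ := (isCompact_univ (X := ProbabilityMeasure E)).ultrafilter_le_nhds
    ((hyperfilter ℕ).map (chainLaw μ hμ x₀)) (by simp)
  have hlim : Tendsto (chainLaw μ hμ x₀) (hyperfilter ℕ) (𝓝 ν) := hν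
  rw [ProbabilityMeasure.tendsto_iff_forall_integral_rclike_tendsto ℂ] at hlim
  have hlim' : ∀ (c : ℝ) (φ : E → ℂ), 0 ≤ c → TruncHolder K α c φ →
      Tendsto (fun n => (transitionOp μ)^[n] φ x₀) (hyperfilter ℕ) (𝓝 (∫ x, φ x ∂ν)) := by
    intro c φ hc hφ
    have := hlim (BoundedContinuousFunction.mkOfCompact ⟨φ, hφ.continuous hα⟩)
    refine this.congr fun n => ?_
    exact integral_chainLaw hμ x₀ hP hα hK0 hb n hc hφ
  refine ⟨ν, inferInstance, isInvariant_of_comp_eq hμ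
    (ext_of_forall_lipschitz_integral_eq fun f hf => ?_)⟩
  have hmem := memHolder_ofReal_comp hα1 hf
  have hφ := truncHolder_of_memHolder hα hK hmem
  set c := 2 * holderNorm α fun x => (f x : ℂ)
  have hc : 0 ≤ c := mul_nonneg zero_le_two (holderNorm_nonneg _ _)
  have hcont := hφ.continuous hα
  obtain ⟨B, hB⟩ := exists_norm_le_of_continuous hcont
  rw [integral_comp_stepKernel hμ _ hcont.measurable hB]
  have t1 := hlim' c _ hc hφ
  have t2 := hlim' c _ hc (hφ.transitionOp hP hα hK0 hb hc)
  have t3 : Tendsto (fun n => (transitionOp μ)^[n] (transitionOp μ fun x => (f x : ℂ)) x₀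
      - (transitionOp μ)^[n] (fun x => (f x : ℂ)) x₀) (hyperfilter ℕ) (𝓝 0) := by
    rw [tendsto_zero_iff_norm_tendsto_zero]
    refine squeeze_zero (g := fun n => κ * ρ ^ n * c) (fun _ => norm_nonneg _) (fun n => ?_) ?_
    · have hψ := (hφ.iterate_transitionOp hP hα hK0 hb hc n).continuous hα
      rw [← Function.iterate_succ_apply, Function.iterate_succ_apply']
      -- `P ^ (n + 1) φ x₀` averages the values `P ^ n φ (T x₀)`, so it differs from `P ^ n φ x₀` by
      -- at most the oscillation of `P ^ n φ`.
      have := norm_integral_sub_integral_le_mul_mass (σ := μ x₀) (τ := Measure.dirac x₀)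
        (by simp) (integrable_comp_eval hψ x₀ (μ x₀))
        (integrable_const ((transitionOp μ)^[n] (fun x => (f x : ℂ)) x₀))
        fun T _ => hdec c _ hc hφ n (T x₀) x₀
      simpa [transitionOp] using this
    · have : Tendsto (fun n : ℕ => κ * ρ ^ n * c) atTop (𝓝 (κ * 0 * c)) :=
        ((tendsto_pow_atTop_nhds_zero_of_lt_one hρ0.le hρ1).const_mul κ).mul_const c
      simp only [mul_zero, zero_mul] at this
      exact this.mono_left Nat.hyperfilter_le_atTop
  have t4 := t2.sub t1
  exact sub_eq_zero.1 (tendsto_nhds_unique t4 t3)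

end Invariant

end IFS

/-! ### The main theorem. -/

theorem mainTheorem1 {E : Type*} [MetricSpace E] [CompactSpace E] [MeasurableSpace E]
    [BorelSpace E]
    (μ : E → Measure (IFS.LipMap E)) [∀ x, IsProbabilityMeasure (μ x)]
    (α : ℝ≥0) (hα0 : 0 < α) (hα1 : α ≤ 1)
    (H1 : IFS.meanContraction α μ < 1)
    (H2 : IFS.tvHolderCoeff α μ < ∞)
    (H3 : ∃ (δ : ℝ) (m : Measure (IFS.LipMap E)), 0 < δ ∧ IsProbabilityMeasure m ∧
      (∀ x, ENNReal.ofReal δ • m ≤ μ x) ∧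
      ∃ ξ : ℕ → IFS.LipMap E, (∀ n, ξ n ∈ IFS.closedSemigroup m) ∧
        IFS.IsContractingSeq fun n => (ξ n).toContinuousMap) :
    ∃ ν : Measure E,
      (IsProbabilityMeasure ν ∧ IFS.IsInvariant μ ν) ∧
      (∀ ν' : Measure E, IsProbabilityMeasure ν' → IFS.IsInvariant μ ν' → ν' = ν) ∧
      ∃ κ ρ : ℝ, 0 < κ ∧ 0 < ρ ∧ ρ < 1 ∧
        ∀ φ : E → ℂ, MemHolder α φ → ∀ (x : E) (n : ℕ),
          ‖((IFS.transitionOp μ)^[n] φ) x - ∫ y, φ y ∂ν‖ ≤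
            κ * ρ ^ n * IFS.holderNorm α φ := by
  obtain ⟨δ, m, hδ, hm, hle, ξ, hξ, hcontr⟩ := H3
  -- Only a point of `E` is wanted here: (H3) forces `E` to be nonempty.
  obtain ⟨x₀, -⟩ := id hcontr
  obtain ⟨K, b, hK, hb0, hb, hP⟩ := IFS.exists_locallyContracts hα0 H1 H2
  have hK0 : 0 ≤ K := zero_le_one.trans hK
  have hdecay := IFS.exists_geometric_oscillation_decay hP hα0 hK0 hb0 hb
    (IFS.isMixingPair_of_contractingSeq hP hα0 hK0 hb.le hδ hle hξ hcontr)
  obtain ⟨ν, hν, hinv⟩ := IFS.exists_isInvariant (IFS.measurable_of_tvHolderCoeff hα0 H2.ne) x₀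
    hP hα0 hα1 hK hb.le hdecay
  obtain ⟨κ, ρ, hκ, hρ0, hρ1, hdec⟩ := hdecay
  -- Stated for every invariant probability measure, so that it yields both the rate for `ν` and
  -- uniqueness.
  have hrate : ∀ ν' : Measure E, IsProbabilityMeasure ν' → IFS.IsInvariant μ ν' →
      ∀ φ : E → ℂ, MemHolder α φ → ∀ (x : E) (n : ℕ),
        ‖((IFS.transitionOp μ)^[n] φ) x - ∫ y, φ y ∂ν'‖ ≤
          2 * κ * ρ ^ n * IFS.holderNorm α φ := by
    intro ν' _ hinv' φ hφ x n
    have hc : 0 ≤ 2 * IFS.holderNorm α φ := mul_nonneg zero_le_two (IFS.holderNorm_nonneg _ _)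
    have hφ' := IFS.truncHolder_of_memHolder hα0 hK hφ
    refine (hinv'.norm_iterate_sub_integral_le hP hα0 hK0 hb.le hc hφ'
      (hdec _ φ hc hφ' n) x).trans_eq ?_
    ring
  refine ⟨ν, ⟨hν, hinv⟩, fun ν' hν' hinv' => ?_, 2 * κ, ρ, by positivity, hρ0, hρ1,
    hrate ν hν hinv⟩
  refine IFS.ext_of_forall_lipschitz_integral_eq fun f hf => ?_
  have hmem := IFS.memHolder_ofReal_comp hα1 hf
  have hlim : ∀ ν'' : Measure E, IsProbabilityMeasure ν'' → IFS.IsInvariant μ ν'' →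
      Filter.Tendsto (fun n => ((IFS.transitionOp μ)^[n] fun x => (f x : ℂ)) x₀) Filter.atTop
        (nhds (∫ x, (f x : ℂ) ∂ν'')) := by
    intro ν'' h1 h2
    rw [tendsto_iff_norm_sub_tendsto_zero]
    refine squeeze_zero (fun _ => norm_nonneg _) (fun n => hrate ν'' h1 h2 _ hmem x₀ n) ?_
    simpa using ((tendsto_pow_atTop_nhds_zero_of_lt_one hρ0.le hρ1).const_mul
      (2 * κ)).mul_const (IFS.holderNorm α fun x => (f x : ℂ))
  exact tendsto_nhds_unique (hlim ν' hν' hinv') (hlim ν hν hinv)
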